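/- Let $d\in\mathbb{N}$, let $\|\cdot\|$ be the Euclidean norm on $\mathbb{R}^d$, and let $\mathcal{P}(\mathbb{R}^d)$ be the set of Borel probability measures on $\mathbb{R}^d$. For $\mu,\nu\in\mathcal{P}(\mathbb{R}^d)$ let $\mathsf{W}_1(\mu,\nu)=\inf_{\pi}\int\|x-y\|\,\mathrm{d}\pi(x,y)\in[0,\infty]$, the infimum being over all probability measures $\pi$ on $\mathbb{R}^d\times\mathbb{R}^d$ with first marginal $\mu$ and second marginal $\nu$, be the 1-Wasserstein distance. For $\sigma\ge 0$ let $\mathsf{W}_1^{(\sigma)}(\mu,\nu)=\mathsf{W}_1(\mu*\mathcal{N}_\sigma,\nu*\mathcal{N}_\sigma)$, where $*$ is convolution and $\mathcal{N}_\sigma=\mathcal{N}(0,\sigma^2 I_d)$ (the Dirac measure at $0$ if $\sigma=0$). Write $\mathbb{E}_\mu\|X\|=\int\|x\|\,\mathrm{d}\mu(x)\in[0,\infty]$. Theorem. Let $\sigma\ge 0$, let $(\mu_k)_{k\in\mathbb{N}}$ be a sequence in $\mathcal{P}(\mathbb{R}^d)$, and let $\mu\in\mathcal{P}(\mathbb{R}^d)$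 satisfy $\mathbb{E}_\mu\|X\|<\infty$. Then $\mathsf{W}_1^{(\sigma)}(\mu_k,\mu)\to 0$ as $k\to\infty$ if and only if $\mathbb{E}_{\mu_k}\|X\|\to\mathbb{E}_\mu\|X\|$ and $\mu_k$ converges weakly to $\mu$ (that is, $\int f\,\mathrm{d}\mu_k\to\int f\,\mathrm{d}\mu$ for every bounded continuous $f:\mathbb{R}^d\to\mathbb{R}$). Consequently, $\mathsf{W}_1^{(\sigma)}(\mu_k,\mu)\to 0$ if and only if $\mathsf{W}_1(\mu_k,\mu)\to 0$. -/

import Mathlib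

open MeasureTheory ProbabilityTheory Filter Topology
open scoped ENNReal

noncomputable section

/-- The transport plans (couplings) between two measures on `ℝ^d`: the probability measures on
`ℝ^d × ℝ^d` with first marginal `μ` and second marginal `ν`. -/
def couplings {d : ℕ} (μ ν : Measure (EuclideanSpace ℝ (Fin d))) :
    Set (Measure (EuclideanSpace ℝ (Fin d) × EuclideanSpace ℝ (Fin d))) :=
  {π | IsProbabilityMeasure π ∧ π.fst = μ ∧ π.snd = ν}

/-- The 1-Wasserstein distance for the Euclidean cost, with values in `[0, ∞]`. -/
def W1 {d : ℕ} (μ ν : Measure (EuclideanSpace ℝ (Fin d))) : ℝ≥0∞ :=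
  ⨅ π ∈ couplings μ ν, ∫⁻ p, ‖p.1 - p.2‖ₑ ∂π

/-- The isotropic Gaussian measure `N(0, σ² I_d)`; it is the Dirac mass at `0` for `σ = 0`. -/
def isoGaussian (d : ℕ) (σ : ℝ) : Measure (EuclideanSpace ℝ (Fin d)) :=
  multivariateGaussian 0 (σ ^ 2 • (1 : Matrix (Fin d) (Fin d) ℝ))

/-- The Gaussian-smoothed 1-Wasserstein distance
`W₁(μ ∗ N(0, σ² I_d), ν ∗ N(0, σ² I_d))`. -/
def smoothedW1 {d : ℕ} (σ : ℝ) (μ ν : Measure (EuclideanSpace ℝ (Fin d))) : ℝ≥0∞ :=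
  W1 (μ.conv (isoGaussian d σ)) (ν.conv (isoGaussian d σ))

/-- The first absolute moment `E_μ ‖X‖`, with values in `[0, ∞]`. -/
def firstMoment {d : ℕ} (μ : Measure (EuclideanSpace ℝ (Fin d))) : ℝ≥0∞ :=
  ∫⁻ x, ‖x‖ₑ ∂μ

end

/-! Adding the same independent noise to both coordinates of a coupling keeps the cost, so smoothing
never increases `W1` (`W1_conv_le`). Conversely, characteristic functions at `t` differ by at most
`‖t‖` times `W1`. The Gaussian one never vanishes and can be divided out, so smoothed convergence
implies weak convergence (`tendsto_of_tendsto_W1_conv`). It also gives convergence of the smoothed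
first moments, and the noise alters a moment only by the integral of a bounded continuous function,
up to a constant (`tendsto_firstMoment_of_conv`). Finally, weak convergence and convergence of
moments give `W1` convergence through an explicit coupling (`tendsto_W1_of_tendsto`): mass is
matched inside small cells covering a compact set that carries almost all of the moment, and the
remainder costs at most the residual moments. -/

/-! ### Elementary properties of `W1`. -/

/-- The first moments of two measures differ by at most their
Wasserstein distance. -/
lemma firstMoment_le_add_W1 {d : ℕ} (μ ν : Measure (EuclideanSpace ℝ (Fin d))) :
    firstMoment μ ≤ firstMoment ν + W1 μ ν := by
  unfold W1
  rw [ENNReal.add_iInf]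
  refine le_iInf fun π => ?_
  by_cases hπ : π ∈ couplings μ ν
  swap
  · simp [hπ]
  rw [iInf_pos hπ]
  obtain ⟨-, h1, h2⟩ := hπ
  rw [← h1, ← h2]
  unfold firstMoment Measure.fst Measure.snd
  rw [lintegral_map (by fun_prop) measurable_fst, lintegral_map (by fun_prop) measurable_snd,
    ← lintegral_add_left (by fun_prop)]
  refine lintegral_mono fun p => ?_
  calc ‖p.1‖ₑ = ‖p.2 + (p.1 - p.2)‖ₑ := by rw [add_sub_cancel]
    _ ≤ _ := enorm_add_le _ _

lemma couplings_swap {d : ℕ} {μ ν : Measure (EuclideanSpace ℝ (Fin d))}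
    {π : Measure (EuclideanSpace ℝ (Fin d) × EuclideanSpace ℝ (Fin d))}
    (hπ : π ∈ couplings μ ν) : π.map Prod.swap ∈ couplings ν μ := by
  obtain ⟨h, h1, h2⟩ := hπ
  refine ⟨Measure.isProbabilityMeasure_map (by fun_prop), ?_, ?_⟩
  · rw [← h2, Measure.fst_map_swap]
  · rw [← h1, Measure.snd_map_swap]

lemma W1_comm {d : ℕ} (μ ν : Measure (EuclideanSpace ℝ (Fin d))) : W1 μ ν = W1 ν μ := by
  have key : ∀ μ ν : Measure (EuclideanSpace ℝ (Fin d)), W1 μ ν ≤ W1 ν μ := by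
    intro μ ν
    refine le_iInf₂ fun π hπ => ?_
    refine (iInf₂_le _ (couplings_swap hπ)).trans ?_
    rw [lintegral_map (by fun_prop) measurable_swap]
    refine lintegral_mono fun p => ?_
    simp only [Prod.fst_swap, Prod.snd_swap]
    rw [← enorm_neg, neg_sub]
  exact le_antisymm (key _ _) (key _ _)

/-- Convolution with a probability measure does not increase the Wasserstein distance. -/
lemma W1_conv_le {d : ℕ} (μ ν γ : Measure (EuclideanSpace ℝ (Fin d))) [IsProbabilityMeasure γ] :
    W1 (μ.conv γ) (ν.conv γ) ≤ W1 μ ν := by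
  refine le_iInf₂ fun π hπ => ?_
  obtain ⟨hp, h1, h2⟩ := hπ
  -- The same noise shifts both points, so their difference is unchanged.
  let T : (EuclideanSpace ℝ (Fin d) × EuclideanSpace ℝ (Fin d)) × EuclideanSpace ℝ (Fin d) →
    EuclideanSpace ℝ (Fin d) × EuclideanSpace ℝ (Fin d) := fun q => (q.1.1 + q.2, q.1.2 + q.2)
  have hT : Measurable T := by fun_prop
  have hmem : (π.prod γ).map T ∈ couplings (μ.conv γ) (ν.conv γ) := by
    refine ⟨Measure.isProbabilityMeasure_map hT.aemeasurable, ?_, ?_⟩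
    · rw [← h1, Measure.conv, Measure.fst, Measure.fst, Measure.map_map measurable_fst hT]
      conv_rhs => rw [← Measure.map_id (μ := γ)]
      rw [Measure.map_prod_map _ _ measurable_fst measurable_id,
        Measure.map_map (by fun_prop) (by fun_prop)]
      rfl
    · rw [← h2, Measure.conv, Measure.snd, Measure.snd, Measure.map_map measurable_snd hT]
      conv_rhs => rw [← Measure.map_id (μ := γ)]
      rw [Measure.map_prod_map _ _ measurable_snd measurable_id,
        Measure.map_map (by fun_prop) (by fun_prop)]
      rfl
  refine (iInf₂_le _ hmem).trans ?_
  rw [lintegral_map (by fun_prop) hT]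
  simp only [T, add_sub_add_right_eq_sub]
  rw [lintegral_prod _ (by fun_prop)]
  simp

/-! ### Characteristic functions and deconvolution. -/

open Complex in
lemma enorm_cexp_inner_sub_le {E : Type*} [NormedAddCommGroup E] [InnerProductSpace ℝ E]
    (x y t : E) :
    ‖cexp (inner ℝ x t * I) - cexp (inner ℝ y t * I)‖ₑ ≤ ‖t‖ₑ * ‖x - y‖ₑ := by
  -- Factoring out a unimodular phase leaves `|exp(is) - 1| ≤ |s|` and Cauchy–Schwarz.
  have h : cexp (inner ℝ x t * I) - cexp (inner ℝ y t * I) =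
      cexp (inner ℝ y t * I) * (cexp (I * (inner ℝ (x - y) t : ℝ)) - 1) := by
    rw [mul_sub, ← Complex.exp_add, inner_sub_left]
    push_cast
    ring_nf
  rw [h, enorm_mul]
  have h1 : ‖cexp (inner ℝ y t * I)‖ₑ = 1 := by
    rw [enorm_eq_iff_norm_eq (y := (1 : ℝ)) |>.2 (by simp [norm_exp_ofReal_mul_I])]
    simp
  rw [h1, one_mul]
  refine Real.enorm_exp_I_mul_ofReal_sub_one_le.trans ?_
  rw [← ofReal_norm, ← ofReal_norm, ← ofReal_norm,
    ← ENNReal.ofReal_mul (norm_nonneg _), mul_comm]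
  exact ENNReal.ofReal_le_ofReal (norm_inner_le_norm _ _)

/-- The pointwise Lipschitz bound is integrated against each coupling. -/
lemma enorm_charFun_sub_le {d : ℕ} (μ ν : Measure (EuclideanSpace ℝ (Fin d)))
    [IsProbabilityMeasure μ] [IsProbabilityMeasure ν] (t : EuclideanSpace ℝ (Fin d)) :
    ‖charFun μ t - charFun ν t‖ₑ ≤ ‖t‖ₑ * W1 μ ν := by
  rcases eq_or_ne t 0 with rfl | ht
  · simp
  have ht' : ‖t‖ₑ ≠ 0 := by simpa using ht
  unfold W1
  rw [ENNReal.mul_iInf_of_ne ht' (by simp)]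
  refine le_iInf fun π => ?_
  rw [ENNReal.mul_iInf_of_ne ht' (by simp)]
  refine le_iInf fun ⟨hp, h1, h2⟩ => ?_
  have hint : ∀ f : EuclideanSpace ℝ (Fin d) × EuclideanSpace ℝ (Fin d) →
      EuclideanSpace ℝ (Fin d), Measurable f →
      Integrable (fun p => Complex.exp (inner ℝ (f p) t * Complex.I)) π := by
    intro f hf
    refine Integrable.of_bound (by fun_prop) 1 (ae_of_all _ fun p => ?_)
    rw [Complex.norm_exp_ofReal_mul_I]
  rw [charFun_apply, charFun_apply, ← h1, ← h2, Measure.fst, Measure.snd,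
    integral_map (by fun_prop) (by fun_prop), integral_map (by fun_prop) (by fun_prop),
    ← integral_sub (hint _ measurable_fst) (hint _ measurable_snd),
    ← lintegral_const_mul _ (by fun_prop)]
  exact (enorm_integral_le_lintegral_enorm _).trans
    (lintegral_mono fun p => enorm_cexp_inner_sub_le _ _ _)

instance (d : ℕ) (σ : ℝ) : IsGaussian (isoGaussian d σ) := by
  unfold isoGaussian; infer_instance

/-- Deconvolution: if smoothing by `γ` with nowhere vanishing characteristic function yields
Wasserstein convergence, then the original sequence converges weakly. -/
lemma tendsto_of_tendsto_W1_conv {d : ℕ} {γ : Measure (EuclideanSpace ℝ (Fin d))}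
    [IsProbabilityMeasure γ] (hγ : ∀ t, charFun γ t ≠ 0)
    {μs : ℕ → ProbabilityMeasure (EuclideanSpace ℝ (Fin d))}
    {μ : ProbabilityMeasure (EuclideanSpace ℝ (Fin d))}
    (h : Tendsto (fun k => W1 ((μs k : Measure _).conv γ) ((μ : Measure _).conv γ)) atTop (𝓝 0)) :
    Tendsto μs atTop (𝓝 μ) := by
  rw [ProbabilityMeasure.tendsto_iff_tendsto_charFun]
  intro t
  have h1 : Tendsto (fun k => charFun ((μs k : Measure _).conv γ) t) atTop
      (𝓝 (charFun ((μ : Measure _).conv γ) t)) := by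
    rw [tendsto_iff_edist_tendsto_0]
    have h2 := ENNReal.Tendsto.const_mul (a := ‖t‖ₑ) h (Or.inr (by simp))
    rw [mul_zero] at h2
    refine tendsto_of_tendsto_of_tendsto_of_le_of_le tendsto_const_nhds h2
      (fun _ => zero_le) fun k => ?_
    rw [edist_eq_enorm_sub]
    exact enorm_charFun_sub_le _ _ t
  simp only [charFun_conv] at h1
  simpa [hγ t] using h1.mul_const (charFun γ t)⁻¹

lemma charFun_ne_zero_of_isGaussian {E : Type*} [NormedAddCommGroup E] [InnerProductSpace ℝ E]
    [MeasurableSpace E] [BorelSpace E] (γ : Measure E) [IsGaussian γ] (t : E) :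
    charFun γ t ≠ 0 := by
  rw [IsGaussian.charFun_eq]
  exact Complex.exp_ne_zero _

/-! ### Convergence of first moments. -/

lemma tendsto_firstMoment_of_tendsto_W1 {d : ℕ} {μs : ℕ → Measure (EuclideanSpace ℝ (Fin d))}
    {μ : Measure (EuclideanSpace ℝ (Fin d))} (hμ : firstMoment μ < ∞)
    (h : Tendsto (fun k => W1 (μs k) μ) atTop (𝓝 0)) :
    Tendsto (fun k => firstMoment (μs k)) atTop (𝓝 (firstMoment μ)) := by
  have h1 : Tendsto (fun k => firstMoment μ - W1 (μs k) μ) atTop (𝓝 (firstMoment μ - 0)) :=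
    ENNReal.Tendsto.sub tendsto_const_nhds h (Or.inl hμ.ne)
  have h2 : Tendsto (fun k => firstMoment μ + W1 (μs k) μ) atTop (𝓝 (firstMoment μ + 0)) :=
    tendsto_const_nhds.add h
  rw [tsub_zero] at h1
  rw [add_zero] at h2
  refine tendsto_of_tendsto_of_tendsto_of_le_of_le h1 h2 (fun k => ?_)
    fun k => firstMoment_le_add_W1 _ _
  rw [tsub_le_iff_right, W1_comm]
  exact firstMoment_le_add_W1 _ _

/-- If a sequence converges weakly and the first moments of its convolutions with `γ` converge,
then so do its first moments: `x ↦ ∫ ‖x + z‖ dγ(z) - ‖x‖` is bounded and continuous. -/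
lemma tendsto_firstMoment_of_conv {d : ℕ} {γ : Measure (EuclideanSpace ℝ (Fin d))}
    [IsProbabilityMeasure γ] (hγ : Integrable id γ)
    {μs : ℕ → ProbabilityMeasure (EuclideanSpace ℝ (Fin d))}
    {μ : ProbabilityMeasure (EuclideanSpace ℝ (Fin d))} (hw : Tendsto μs atTop (𝓝 μ))
    (h : Tendsto (fun k => firstMoment ((μs k : Measure (EuclideanSpace ℝ (Fin d))).conv γ)) atTop
      (𝓝 (firstMoment ((μ : Measure (EuclideanSpace ℝ (Fin d))).conv γ)))) :
    Tendsto (fun k => firstMoment (μs k : Measure (EuclideanSpace ℝ (Fin d)))) atTop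
      (𝓝 (firstMoment (μ : Measure (EuclideanSpace ℝ (Fin d))))) := by
  set C : ℝ := ∫ z, ‖z‖ ∂γ with hC
  let g : EuclideanSpace ℝ (Fin d) → ℝ := fun x => ∫ z, ‖x + z‖ ∂γ
  have hγ' : Integrable (fun z => z) γ := hγ
  have hint : ∀ x, Integrable (fun z => ‖x + z‖) γ := fun x =>
    ((integrable_const x).add hγ').norm
  have hlip : ∀ x y, g x ≤ g y + ‖x - y‖ := by
    intro x y
    have : g y + ‖x - y‖ = ∫ z, (‖y + z‖ + ‖x - y‖) ∂γ := by
      rw [integral_add (hint y) (integrable_const _)]; simp [g]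
    rw [this]
    refine integral_mono (hint x) ((hint y).add (integrable_const _)) fun z => ?_
    calc ‖x + z‖ = ‖(y + z) + (x - y)‖ := by congr 1; abel
      _ ≤ _ := norm_add_le _ _
  have hg0 : g 0 = C := by simp [g, hC]
  have hgc : Continuous g := by
    refine (LipschitzWith.of_le_add fun x y => ?_ : LipschitzWith 1 g).continuous
    rw [dist_eq_norm]; exact hlip x y
  have hg1 : ∀ x, g x ≤ C + ‖x‖ := fun x => by simpa [hg0] using hlip x 0
  have hg2 : ∀ x, ‖x‖ ≤ C + g x := by
    intro x
    have : ∫ z, (‖z‖ + ‖x + z‖) ∂γ = C + g x := integral_add hγ'.norm (hint x)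
    rw [← this]
    have h3 : ‖x‖ = ∫ _, ‖x‖ ∂γ := by simp
    rw [h3]
    refine integral_mono (integrable_const _) (hγ'.norm.add (hint x)) fun z => ?_
    calc ‖x‖ = ‖(x + z) - z‖ := by rw [add_sub_cancel_right]
      _ ≤ ‖x + z‖ + ‖z‖ := norm_sub_le _ _
      _ = _ := add_comm _ _
  -- By `hg1` and `hg2` the function takes values in `[0, 2C]`, so `toNNReal` truncates nothing.
  let f : BoundedContinuousFunction (EuclideanSpace ℝ (Fin d)) NNReal :=
    BoundedContinuousFunction.mkOfBound
      ⟨fun x => (C + ‖x‖ - g x).toNNReal, by fun_prop⟩ (2 * C) (by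
        intro x y
        have hx := hg1 x
        have hx' := hg2 x
        have hy := hg1 y
        have hy' := hg2 y
        rw [NNReal.dist_eq]
        simp only [ContinuousMap.coe_mk]
        rw [Real.coe_toNNReal _ (by linarith), Real.coe_toNNReal _ (by linarith), abs_le]
        constructor <;> linarith)
  -- Stated additively because the moments of `ν` may be infinite.
  have key : ∀ ν : ProbabilityMeasure (EuclideanSpace ℝ (Fin d)),
      firstMoment ((ν : Measure (EuclideanSpace ℝ (Fin d))).conv γ) +
          ∫⁻ x, f x ∂(ν : Measure (EuclideanSpace ℝ (Fin d))) =
        ENNReal.ofReal C + firstMoment (ν : Measure (EuclideanSpace ℝ (Fin d))) := by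
    intro ν
    unfold firstMoment
    rw [Measure.lintegral_conv (by fun_prop), ← lintegral_add_right _ (by fun_prop)]
    have : ∀ x, (∫⁻ y, ‖x + y‖ₑ ∂γ) + f x = ENNReal.ofReal C + ‖x‖ₑ := by
      intro x
      have h4 : ∫⁻ y, ‖x + y‖ₑ ∂γ = ENNReal.ofReal (g x) := by
        simp_rw [← ofReal_norm]
        exact (ofReal_integral_eq_lintegral_ofReal (hint x)
          (ae_of_all _ fun _ => norm_nonneg _)).symm
      have h5 : (f x : ℝ≥0∞) = ENNReal.ofReal (C + ‖x‖ - g x) := rfl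
      rw [h4, h5, ← ofReal_norm, ← ENNReal.ofReal_add, ← ENNReal.ofReal_add]
      · congr 1; ring
      · exact integral_nonneg fun _ => norm_nonneg _
      · exact norm_nonneg _
      · exact integral_nonneg fun _ => norm_nonneg _
      · linarith [hg1 x]
    simp_rw [this]
    rw [lintegral_add_left measurable_const]
    simp
  have h6 := h.add ((ProbabilityMeasure.tendsto_iff_forall_lintegral_tendsto.1 hw) f)
  simp_rw [key] at h6
  have h7 := ENNReal.Tendsto.sub h6 (tendsto_const_nhds (x := ENNReal.ofReal C))
    (Or.inr ENNReal.ofReal_ne_top)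
  simpa [ENNReal.add_sub_cancel_left] using h7

lemma firstMoment_conv_lt_top {d : ℕ} {μ γ : Measure (EuclideanSpace ℝ (Fin d))}
    [IsProbabilityMeasure μ] [IsProbabilityMeasure γ] (hμ : firstMoment μ < ∞)
    (hγ : Integrable id γ) : firstMoment (μ.conv γ) < ∞ := by
  unfold firstMoment at hμ ⊢
  rw [Measure.lintegral_conv (by fun_prop)]
  calc ∫⁻ x, ∫⁻ y, ‖x + y‖ₑ ∂γ ∂μ ≤ ∫⁻ x, ∫⁻ y, (‖x‖ₑ + ‖y‖ₑ) ∂γ ∂μ :=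
        lintegral_mono fun x => lintegral_mono fun y => enorm_add_le x y
    _ = ∫⁻ x, ‖x‖ₑ ∂μ + ∫⁻ y, ‖y‖ₑ ∂γ := by
        simp_rw [lintegral_add_left measurable_const]
        rw [lintegral_add_right _ measurable_const]
        simp
    _ < ∞ := ENNReal.add_lt_top.2 ⟨hμ, hγ.2⟩

/-! ### Construction of couplings from partial plans. -/

/-- A partial transport plan `π` is completed to a coupling by the normalised product of the
residual marginals. -/
lemma W1_add_le_of_fst_le_of_snd_le {d : ℕ} {α β : Measure (EuclideanSpace ℝ (Fin d))}
    [IsProbabilityMeasure α] [IsProbabilityMeasure β]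
    {π : Measure (EuclideanSpace ℝ (Fin d) × EuclideanSpace ℝ (Fin d))}
    (h1 : π.fst ≤ α) (h2 : π.snd ≤ β) :
    W1 α β + (firstMoment π.fst + firstMoment π.snd) ≤
      ∫⁻ p, ‖p.1 - p.2‖ₑ ∂π + (firstMoment α + firstMoment β) := by
  have hf1 : IsFiniteMeasure π.fst := isFiniteMeasure_of_le α h1
  have hf2 : IsFiniteMeasure π.snd := isFiniteMeasure_of_le β h2
  set α' := α - π.fst with hα'
  set β' := β - π.snd with hβ'
  have hα : α' + π.fst = α := Measure.sub_add_cancel_of_le h1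
  have hβ : β' + π.snd = β := Measure.sub_add_cancel_of_le h2
  have hr : α' Set.univ = β' Set.univ := by
    rw [hα', hβ', Measure.sub_apply .univ h1, Measure.sub_apply .univ h2, Measure.fst_univ,
      Measure.snd_univ, measure_univ (μ := α), measure_univ (μ := β)]
  -- If the residual mass is `0`, the factor is `∞`, but both residuals are then the zero measure.
  set ρ := (α' Set.univ)⁻¹ • α'.prod β' with hρ
  have hρ1 : ρ.fst = α' := by
    rw [hρ, Measure.fst, Measure.map_smul, Measure.map_fst_prod, smul_smul, ← hr]
    rcases eq_or_ne (α' Set.univ) 0 with h0 | h0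
    · rw [Measure.measure_univ_eq_zero.1 h0, smul_zero]
    · rw [ENNReal.inv_mul_cancel h0 (measure_ne_top _ _), one_smul]
  have hρ2 : ρ.snd = β' := by
    rw [hρ, Measure.snd, Measure.map_smul, Measure.map_snd_prod, smul_smul, hr]
    rcases eq_or_ne (β' Set.univ) 0 with h0 | h0
    · rw [Measure.measure_univ_eq_zero.1 h0, smul_zero]
    · rw [ENNReal.inv_mul_cancel h0 (measure_ne_top _ _), one_smul]
  have hmem : ρ + π ∈ couplings α β := by
    have hfst : (ρ + π).fst = α := by
      rw [Measure.fst_add, hρ1, hα]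
    refine ⟨⟨?_⟩, hfst, ?_⟩
    · rw [← Measure.fst_univ, hfst, measure_univ]
    · rw [Measure.snd_add, hρ2, hβ]
  have hcost : ∫⁻ p, ‖p.1 - p.2‖ₑ ∂ρ ≤ firstMoment α' + firstMoment β' := by
    rw [← hρ1, ← hρ2]
    unfold firstMoment Measure.fst Measure.snd
    rw [lintegral_map (by fun_prop) measurable_fst, lintegral_map (by fun_prop) measurable_snd,
      ← lintegral_add_left (by fun_prop)]
    exact lintegral_mono fun p => enorm_sub_le
  have hW : W1 α β ≤ firstMoment α' + firstMoment β' + ∫⁻ p, ‖p.1 - p.2‖ₑ ∂π := by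
    refine (iInf₂_le _ hmem).trans ?_
    rw [lintegral_add_measure]
    gcongr
  have hα2 : firstMoment α = firstMoment α' + firstMoment π.fst := by
    conv_lhs => rw [← hα]
    exact lintegral_add_measure _ _ _
  have hβ2 : firstMoment β = firstMoment β' + firstMoment π.snd := by
    conv_lhs => rw [← hβ]
    exact lintegral_add_measure _ _ _
  rw [hα2, hβ2]
  calc _ ≤ firstMoment α' + firstMoment β' + ∫⁻ p, ‖p.1 - p.2‖ₑ ∂π +
        (firstMoment π.fst + firstMoment π.snd) := by gcongr
    _ = _ := by abel

/-- Gluing local product plans along a family of functions of small support. -/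
lemma W1_add_sum_le {d : ℕ} {α β : Measure (EuclideanSpace ℝ (Fin d))}
    [IsProbabilityMeasure α] [IsProbabilityMeasure β] {ι : Type*} [Fintype ι]
    {f : ι → EuclideanSpace ℝ (Fin d) → ℝ≥0∞} (hf : ∀ i, Measurable (f i))
    (hsum : ∀ x, ∑ i, f i x ≤ 1) {ε : ℝ≥0∞}
    (hε : ∀ i x y, f i x ≠ 0 → f i y ≠ 0 → ‖x - y‖ₑ ≤ ε) :
    W1 α β + (∑ i, (max (∫⁻ x, f i x ∂α) (∫⁻ x, f i x ∂β))⁻¹ * (∫⁻ x, f i x ∂β) *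
          (∫⁻ x, f i x * ‖x‖ₑ ∂α) +
        ∑ i, (max (∫⁻ x, f i x ∂α) (∫⁻ x, f i x ∂β))⁻¹ * (∫⁻ x, f i x ∂α) *
          (∫⁻ x, f i x * ‖x‖ₑ ∂β)) ≤
      ε + (firstMoment α + firstMoment β) := by
  -- This factor gives cell `i` the smaller of its two masses, so neither marginal is exceeded.
  set c : ι → ℝ≥0∞ := fun i => (max (∫⁻ x, f i x ∂α) (∫⁻ x, f i x ∂β))⁻¹ with hc
  have hca : ∀ i, c i * ∫⁻ x, f i x ∂α ≤ 1 := fun i =>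
    (mul_le_mul_left (ENNReal.inv_le_inv.2 (le_max_left _ _)) _).trans (ENNReal.inv_mul_le_one _)
  have hcb : ∀ i, c i * ∫⁻ x, f i x ∂β ≤ 1 := fun i =>
    (mul_le_mul_left (ENNReal.inv_le_inv.2 (le_max_right _ _)) _).trans (ENNReal.inv_mul_le_one _)
  let π : Measure (EuclideanSpace ℝ (Fin d) × EuclideanSpace ℝ (Fin d)) :=
    Measure.sum fun i => c i • (α.withDensity (f i)).prod (β.withDensity (f i))
  have hfst : π.fst = Measure.sum fun i => (c i * ∫⁻ x, f i x ∂β) • α.withDensity (f i) := by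
    simp only [π, Measure.fst]
    rw [Measure.map_sum (by fun_prop)]
    congr 1; ext1 i
    rw [Measure.map_smul, Measure.map_fst_prod, smul_smul, withDensity_apply _ .univ,
      Measure.restrict_univ]
  have hsnd : π.snd = Measure.sum fun i => (c i * ∫⁻ x, f i x ∂α) • β.withDensity (f i) := by
    simp only [π, Measure.snd]
    rw [Measure.map_sum (by fun_prop)]
    congr 1; ext1 i
    rw [Measure.map_smul, Measure.map_snd_prod, smul_smul, withDensity_apply _ .univ,
      Measure.restrict_univ]
  have hle : ∀ (w : ι → ℝ≥0∞) (ν : Measure (EuclideanSpace ℝ (Fin d))), (∀ i, w i ≤ 1) →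
      Measure.sum (fun i => w i • ν.withDensity (f i)) ≤ ν := by
    intro w ν hw
    refine Measure.le_iff.2 fun s hs => ?_
    rw [Measure.sum_apply _ hs, tsum_fintype]
    calc ∑ i, (w i • ν.withDensity (f i)) s ≤ ∑ i, ∫⁻ x in s, f i x ∂ν := by
          refine Finset.sum_le_sum fun i _ => ?_
          rw [Measure.smul_apply, withDensity_apply _ hs, smul_eq_mul]
          exact mul_le_of_le_one_left' (hw i)
      _ = ∫⁻ x in s, ∑ i, f i x ∂ν := (lintegral_finsetSum _ fun i _ => hf i).symm
      _ ≤ ∫⁻ x in s, 1 ∂ν := lintegral_mono hsum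
      _ = ν s := by simp
  have hmom : ∀ (w : ι → ℝ≥0∞) (ν : Measure (EuclideanSpace ℝ (Fin d))),
      firstMoment (Measure.sum (fun i => w i • ν.withDensity (f i))) =
        ∑ i, w i * ∫⁻ x, f i x * ‖x‖ₑ ∂ν := by
    intro w ν
    unfold firstMoment
    rw [lintegral_sum_measure, tsum_fintype]
    refine Finset.sum_congr rfl fun i _ => ?_
    rw [lintegral_smul_measure, lintegral_withDensity_eq_lintegral_mul _ (hf i) (by fun_prop)]
    rfl
  -- Mass moves at most `ε` within a cell, and the plan has total mass at most `1`.
  have hcost : ∫⁻ p, ‖p.1 - p.2‖ₑ ∂π ≤ ε := by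
    simp only [π]
    rw [lintegral_sum_measure, tsum_fintype]
    calc ∑ i, ∫⁻ p, ‖p.1 - p.2‖ₑ ∂(c i • (α.withDensity (f i)).prod (β.withDensity (f i)))
        ≤ ∑ i, (∫⁻ x, f i x ∂α) * ε := by
          refine Finset.sum_le_sum fun i _ => ?_
          rw [lintegral_smul_measure, prod_withDensity (hf i) (hf i),
            lintegral_withDensity_eq_lintegral_mul _ (by fun_prop) (by fun_prop), smul_eq_mul]
          calc c i * ∫⁻ p, (f i p.1 * f i p.2 * ‖p.1 - p.2‖ₑ) ∂α.prod β
              ≤ c i * ∫⁻ p, f i p.1 * f i p.2 * ε ∂α.prod β := by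
                refine mul_le_mul_right (lintegral_mono fun p => ?_) _
                by_cases hx : f i p.1 = 0
                · simp [hx]
                by_cases hy : f i p.2 = 0
                · simp [hy]
                exact mul_le_mul_right (hε i _ _ hx hy) _
            _ = (c i * ∫⁻ x, f i x ∂β) * ((∫⁻ x, f i x ∂α) * ε) := by
                rw [lintegral_mul_const _ (by fun_prop),
                  lintegral_prod_mul (hf i).aemeasurable (hf i).aemeasurable]
                ring
            _ ≤ _ := mul_le_of_le_one_left' (hcb i)
      _ = (∫⁻ x, ∑ i, f i x ∂α) * ε := by
          rw [lintegral_finsetSum _ fun i _ => hf i, Finset.sum_mul]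
      _ ≤ (∫⁻ _, 1 ∂α) * ε := by gcongr with x; exact hsum x
      _ = ε := by simp
  have h := W1_add_le_of_fst_le_of_snd_le (α := α) (β := β) (π := π)
    (hfst ▸ hle _ _ hcb) (hsnd ▸ hle _ _ hca)
  rw [hfst, hsnd, hmom, hmom] at h
  exact h.trans (by gcongr)

/-! ### From weak convergence and moments to `W1`. -/

/-- Compact support makes test functions such as `f i x * ‖x‖` bounded. -/
lemma tendsto_lintegral_of_hasCompactSupport {X : Type*} [TopologicalSpace X] [MeasurableSpace X]
    [OpensMeasurableSpace X] {μs : ℕ → ProbabilityMeasure X} {μ : ProbabilityMeasure X}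
    (h : Tendsto μs atTop (𝓝 μ)) {f : X → NNReal} (hf : Continuous f)
    (hs : HasCompactSupport f) :
    Tendsto (fun k => ∫⁻ x, f x ∂(μs k : Measure X)) atTop (𝓝 (∫⁻ x, f x ∂(μ : Measure X))) := by
  obtain ⟨C, hC⟩ := Metric.isBounded_iff.1 (hs.isCompact_range hf).isBounded
  exact ProbabilityMeasure.tendsto_iff_forall_lintegral_tendsto.1 h
    (BoundedContinuousFunction.mkOfBound ⟨f, hf⟩ C fun x y =>
      hC (Set.mem_range_self x) (Set.mem_range_self y))

/-- A subordinate partition of unity on a compact set, by functions supported in `ε`-small sets. -/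
lemma exists_partition_of_unity_small {X : Type} [MetricSpace X] [ProperSpace X] {K : Set X}
    (hK : IsCompact K) {ε : ℝ} (hε : 0 < ε) :
    ∃ (ι : Type) (_ : Fintype ι) (f : ι → X → NNReal), (∀ i, Continuous (f i)) ∧
      (∀ i, HasCompactSupport (f i)) ∧ (∀ x, ∑ i, f i x ≤ 1) ∧ (∀ x ∈ K, ∑ i, f i x = 1) ∧
      ∀ i x y, f i x ≠ 0 → f i y ≠ 0 → dist x y ≤ ε := by
  obtain ⟨t, -, ht, hKt⟩ := hK.finite_cover_balls (half_pos hε)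
  have : Fintype t := ht.fintype
  obtain ⟨g, hg⟩ := PartitionOfUnity.exists_isSubordinate_of_locallyFinite (ι := t) hK.isClosed
    (fun q => Metric.ball (q : X) (ε / 2)) (fun _ => Metric.isOpen_ball)
    (locallyFinite_of_finite _) (by simpa [Set.iUnion_subtype] using hKt)
  have hsum : ∀ x, ((∑ i, (g i x).toNNReal : NNReal) : ℝ) = ∑ᶠ i, g i x := by
    intro x
    rw [finsum_eq_sum_of_fintype]
    push_cast
    exact Finset.sum_congr rfl fun i _ => Real.coe_toNNReal _ (g.nonneg i x)
  have hsupp : ∀ i x, (g i x).toNNReal ≠ 0 → x ∈ Metric.ball (i : X) (ε / 2) := by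
    intro i x hx
    refine hg i (subset_tsupport _ fun h => hx ?_)
    simp [h]
  refine ⟨t, this, fun i x => (g i x).toNNReal, fun i => by fun_prop, fun i => ?_, fun x => ?_,
    fun x hx => ?_, fun i x y hx hy => ?_⟩
  · exact HasCompactSupport.of_support_subset_isCompact (isCompact_closedBall (i : X) (ε / 2))
      fun x hx => Metric.ball_subset_closedBall (hsupp i x hx)
  · rw [← NNReal.coe_le_coe, hsum]; exact g.sum_le_one x
  · rw [← NNReal.coe_inj, hsum]; exact g.sum_eq_one hx
  · have h1 := Metric.mem_ball.1 (hsupp i x hx)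
    have h2 := Metric.mem_ball.1 (hsupp i y hy)
    linarith [dist_triangle_right x y (i : X)]

lemma tendsto_inv_max {u : ℕ → ℝ≥0∞} {b : ℝ≥0∞} (hu : Tendsto u atTop (𝓝 b)) :
    Tendsto (fun k => (max (u k) b)⁻¹) atTop (𝓝 b⁻¹) := by
  have := (hu.max (tendsto_const_nhds (x := b)))
  rw [max_self] at this
  exact this.inv

/-- Weak convergence and convergence of first moments imply Wasserstein convergence. -/
lemma tendsto_W1_of_tendsto {d : ℕ} {μs : ℕ → ProbabilityMeasure (EuclideanSpace ℝ (Fin d))}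
    {μ : ProbabilityMeasure (EuclideanSpace ℝ (Fin d))}
    (hμ : firstMoment (μ : Measure (EuclideanSpace ℝ (Fin d))) < ∞)
    (hm : Tendsto (fun k => firstMoment (μs k : Measure (EuclideanSpace ℝ (Fin d)))) atTop
      (𝓝 (firstMoment (μ : Measure (EuclideanSpace ℝ (Fin d))))))
    (hw : Tendsto μs atTop (𝓝 μ)) :
    Tendsto (fun k => W1 (μs k : Measure (EuclideanSpace ℝ (Fin d))) μ) atTop (𝓝 0) := by
  -- The argument yields `3ε` in the limit; `4ε` leaves room for a strict inequality that holds
  -- eventually.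
  set M := firstMoment (μ : Measure (EuclideanSpace ℝ (Fin d))) with hM
  suffices H : ∀ ε : ℝ, 0 < ε →
      ∀ᶠ k in atTop, W1 (μs k : Measure (EuclideanSpace ℝ (Fin d))) μ ≤ 4 * ENNReal.ofReal ε by
    refine ENNReal.tendsto_nhds_zero.2 fun η hη => ?_
    obtain ⟨δ, hδ0, hδ⟩ := ENNReal.lt_iff_exists_nnreal_btwn.1 hη
    filter_upwards [H (δ / 4) (by have := ENNReal.coe_pos.1 hδ0; positivity)] with k hk
    refine hk.trans (le_trans (le_of_eq ?_) hδ.le)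
    rw [← ENNReal.ofReal_coe_nnreal, show (4 : ℝ≥0∞) = ENNReal.ofReal 4 by simp,
      ← ENNReal.ofReal_mul (by norm_num)]
    congr 1; ring
  intro ε hε
  -- Tightness of this finite measure gives a compact set outside which the first moment is at most
  -- `ε`.
  let ν := (μ : Measure (EuclideanSpace ℝ (Fin d))).withDensity fun x => ‖x‖ₑ
  have hν : IsFiniteMeasure ν := isFiniteMeasure_withDensity hμ.ne
  obtain ⟨K, hK, hKε⟩ := isTightMeasureSet_iff_exists_isCompact_measure_compl_le.1
    (isTightMeasureSet_singleton (μ := ν)) (ENNReal.ofReal ε) (by simpa using hε)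
  replace hKε : ν Kᶜ ≤ ENNReal.ofReal ε := hKε ν rfl
  obtain ⟨ι, _, f, hfc, hfs, hf1, hfK, hfε⟩ := exists_partition_of_unity_small hK hε
  set L : ℝ≥0∞ := ∑ i, ∫⁻ x, f i x * ‖x‖ₑ ∂(μ : Measure (EuclideanSpace ℝ (Fin d))) with hL
  have hf1' : ∀ x, ∑ i, (f i x : ℝ≥0∞) ≤ 1 := fun x => by exact_mod_cast hf1 x
  have hLsum : L = ∫⁻ x, (∑ i, (f i x : ℝ≥0∞)) * ‖x‖ₑ ∂(μ : Measure _) := by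
    simp_rw [Finset.sum_mul]
    rw [lintegral_finsetSum _ fun i _ => by have := (hfc i).measurable; fun_prop]
  have hLM : L ≤ M := by
    rw [hLsum]
    exact lintegral_mono fun x => mul_le_of_le_one_left' (hf1' x)
  have hML : M ≤ L + ENNReal.ofReal ε := by
    refine le_trans ?_ (add_le_add_right hKε L)
    rw [withDensity_apply _ hK.isClosed.measurableSet.compl, hM, firstMoment,
      ← lintegral_add_compl _ hK.isClosed.measurableSet, hLsum]
    refine add_le_add_left ?_ _
    refine (setLIntegral_mono' hK.isClosed.measurableSet fun x hx => ?_).trans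
      (setLIntegral_le_lintegral K _)
    have : ∑ i, (f i x : ℝ≥0∞) = 1 := by exact_mod_cast hfK x hx
    rw [this, one_mul]
  have hterm : ∀ i x, (f i x : ℝ≥0∞) * ‖x‖ₑ = ((f i x * ‖x‖₊ : NNReal) : ℝ≥0∞) := by
    intro i x; rw [ENNReal.coe_mul]; rfl
  have ha : ∀ i, Tendsto (fun k => ∫⁻ x, f i x ∂(μs k : Measure (EuclideanSpace ℝ (Fin d)))) atTop
      (𝓝 (∫⁻ x, f i x ∂(μ : Measure (EuclideanSpace ℝ (Fin d))))) := fun i =>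
    tendsto_lintegral_of_hasCompactSupport hw (hfc i) (hfs i)
  have ha' : ∀ i, Tendsto
      (fun k => ∫⁻ x, f i x * ‖x‖ₑ ∂(μs k : Measure (EuclideanSpace ℝ (Fin d)))) atTop
      (𝓝 (∫⁻ x, f i x * ‖x‖ₑ ∂(μ : Measure (EuclideanSpace ℝ (Fin d))))) := by
    intro i
    simp_rw [hterm]
    exact tendsto_lintegral_of_hasCompactSupport hw (by have := hfc i; fun_prop) (hfs i).mul_right
  have hfin : ∀ i, ∫⁻ x, f i x ∂(μ : Measure (EuclideanSpace ℝ (Fin d))) ≠ ∞ := by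
    intro i
    refine ne_top_of_le_ne_top ENNReal.one_ne_top ?_
    calc _ ≤ ∫⁻ x, 1 ∂(μ : Measure (EuclideanSpace ℝ (Fin d))) := lintegral_mono fun x =>
          (Finset.single_le_sum (fun _ _ => zero_le) (Finset.mem_univ i)).trans (hf1' x)
      _ = 1 := by simp
  have hfin' : ∀ i, ∫⁻ x, f i x * ‖x‖ₑ ∂(μ : Measure (EuclideanSpace ℝ (Fin d))) ≠ ∞ := fun i =>
    ne_top_of_le_ne_top hμ.ne ((Finset.single_le_sum (f := fun i => ∫⁻ x, f i x * ‖x‖ₑ ∂(μ : Measure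
      (EuclideanSpace ℝ (Fin d)))) (fun _ _ => zero_le) (Finset.mem_univ i)).trans hLM)
  have hnull : ∀ i, ∫⁻ x, f i x ∂(μ : Measure (EuclideanSpace ℝ (Fin d))) = 0 →
      ∫⁻ x, f i x * ‖x‖ₑ ∂(μ : Measure (EuclideanSpace ℝ (Fin d))) = 0 := by
    intro i h0
    rw [lintegral_eq_zero_iff (by have := (hfc i).measurable; fun_prop)] at h0 ⊢
    filter_upwards [h0] with x hx
    simp_all
  -- `A k` and `B k` are the moments of the two marginals of the glued plan. Both tend to `L`, which
  -- leaves the limiting bound `ε + 2(M - L) ≤ 3ε`.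
  set A : ℕ → ℝ≥0∞ := fun k => ∑ i, (max (∫⁻ x, f i x ∂(μs k : Measure _))
    (∫⁻ x, f i x ∂(μ : Measure _)))⁻¹ * (∫⁻ x, f i x ∂(μ : Measure _)) *
      (∫⁻ x, f i x * ‖x‖ₑ ∂(μs k : Measure _)) with hA
  set B : ℕ → ℝ≥0∞ := fun k => ∑ i, (max (∫⁻ x, f i x ∂(μs k : Measure _))
    (∫⁻ x, f i x ∂(μ : Measure _)))⁻¹ * (∫⁻ x, f i x ∂(μs k : Measure _)) *
      (∫⁻ x, f i x * ‖x‖ₑ ∂(μ : Measure _)) with hB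
  have hAL : Tendsto A atTop (𝓝 L) := by
    refine tendsto_finsetSum _ fun i _ => ?_
    -- A cell that is null for `μ` is treated apart, since its normalising factor tends to `∞`.
    rcases eq_or_ne (∫⁻ x, f i x ∂(μ : Measure (EuclideanSpace ℝ (Fin d)))) 0 with h0 | h0
    · simp [h0, hnull i h0]
    have h1 := ENNReal.Tendsto.mul_const (b := ∫⁻ x, f i x ∂(μ : Measure _))
      (tendsto_inv_max (ha i)) (Or.inr (hfin i))
    rw [ENNReal.inv_mul_cancel h0 (hfin i)] at h1
    simpa using ENNReal.Tendsto.mul h1 (Or.inl one_ne_zero) (ha' i) (Or.inr ENNReal.one_ne_top)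
  have hBL : Tendsto B atTop (𝓝 L) := by
    refine tendsto_finsetSum _ fun i _ => ?_
    rcases eq_or_ne (∫⁻ x, f i x ∂(μ : Measure (EuclideanSpace ℝ (Fin d)))) 0 with h0 | h0
    · simp [hnull i h0]
    have h1 := ENNReal.Tendsto.mul (tendsto_inv_max (ha i))
      (Or.inr (hfin i)) (ha i) (Or.inr (ENNReal.inv_ne_top.2 h0))
    rw [ENNReal.inv_mul_cancel h0 (hfin i)] at h1
    simpa using ENNReal.Tendsto.mul_const h1 (Or.inr (hfin' i))
  have hbound : ∀ k, W1 (μs k : Measure (EuclideanSpace ℝ (Fin d))) μ + (A k + B k) ≤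
      ENNReal.ofReal ε + (firstMoment (μs k : Measure (EuclideanSpace ℝ (Fin d))) + M) := by
    intro k
    refine W1_add_sum_le (f := fun i x => (f i x : ℝ≥0∞))
      (fun i => by have := (hfc i).measurable; fun_prop) hf1' fun i x y hx hy => ?_
    rw [← ofReal_norm, ← dist_eq_norm]
    exact ENNReal.ofReal_le_ofReal (hfε i x y (by simpa using hx) (by simpa using hy))
  have hLtop : L ≠ ∞ := ne_top_of_le_ne_top hμ.ne hLM
  have hlim : Tendsto (fun k => ENNReal.ofReal ε +
      (firstMoment (μs k : Measure (EuclideanSpace ℝ (Fin d))) + M) - (A k + B k)) atTop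
      (𝓝 (ENNReal.ofReal ε + (M + M) - (L + L))) :=
    ENNReal.Tendsto.sub (tendsto_const_nhds.add (hm.add tendsto_const_nhds)) (hAL.add hBL)
      (Or.inr (by simp [hLtop]))
  have hlt : ENNReal.ofReal ε + (M + M) - (L + L) < 4 * ENNReal.ofReal ε := by
    have hε0 : ENNReal.ofReal ε ≠ 0 := by simpa using hε
    calc ENNReal.ofReal ε + (M + M) - (L + L) ≤ 3 * ENNReal.ofReal ε := by
          rw [tsub_le_iff_right]
          calc _ ≤ ENNReal.ofReal ε + ((L + ENNReal.ofReal ε) + (L + ENNReal.ofReal ε)) := by gcongr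
            _ = _ := by ring
      _ < 4 * ENNReal.ofReal ε :=
          ENNReal.mul_lt_mul_left hε0 ENNReal.ofReal_ne_top (by norm_num)
  have hABfin : ∀ᶠ k in atTop, A k + B k < ∞ :=
    (hAL.add hBL).eventually_lt_const (by simpa [lt_top_iff_ne_top] using hLtop)
  filter_upwards [hlim.eventually_lt_const hlt, hABfin] with k hk hk'
  exact (ENNReal.le_sub_of_add_le_right hk'.ne (hbound k)).trans hk.le

theorem theorem2 (d : ℕ) (σ : ℝ) (hσ : 0 ≤ σ)
    (μs : ℕ → ProbabilityMeasure (EuclideanSpace ℝ (Fin d)))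
    (μ : ProbabilityMeasure (EuclideanSpace ℝ (Fin d)))
    (hμ : firstMoment (μ : Measure (EuclideanSpace ℝ (Fin d))) < ∞) :
    (Tendsto (fun k => smoothedW1 σ (μs k : Measure (EuclideanSpace ℝ (Fin d))) μ) atTop (𝓝 0) ↔
      Tendsto (fun k => firstMoment (μs k : Measure (EuclideanSpace ℝ (Fin d)))) atTop
          (𝓝 (firstMoment (μ : Measure (EuclideanSpace ℝ (Fin d))))) ∧
        Tendsto μs atTop (𝓝 μ)) ∧
    (Tendsto (fun k => smoothedW1 σ (μs k : Measure (EuclideanSpace ℝ (Fin d))) μ) atTop (𝓝 0) ↔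
      Tendsto (fun k => W1 (μs k : Measure (EuclideanSpace ℝ (Fin d))) μ) atTop (𝓝 0)) := by
  have smoothed_of_W1 :
      Tendsto (fun k => W1 (μs k : Measure (EuclideanSpace ℝ (Fin d))) μ) atTop (𝓝 0) →
      Tendsto (fun k => smoothedW1 σ (μs k : Measure (EuclideanSpace ℝ (Fin d))) μ) atTop (𝓝 0) :=
    fun h => tendsto_of_tendsto_of_tendsto_of_le_of_le tendsto_const_nhds h
      (fun _ => zero_le) fun _ => W1_conv_le _ _ _
  have weak_of_smoothed :
      Tendsto (fun k => smoothedW1 σ (μs k : Measure (EuclideanSpace ℝ (Fin d))) μ) atTop (𝓝 0) →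
      Tendsto (fun k => firstMoment (μs k : Measure (EuclideanSpace ℝ (Fin d)))) atTop
          (𝓝 (firstMoment (μ : Measure (EuclideanSpace ℝ (Fin d))))) ∧
        Tendsto μs atTop (𝓝 μ) := by
    intro h
    have hw := tendsto_of_tendsto_W1_conv
      (charFun_ne_zero_of_isGaussian (isoGaussian d σ)) h
    exact ⟨tendsto_firstMoment_of_conv IsGaussian.integrable_id hw
      (tendsto_firstMoment_of_tendsto_W1
        (firstMoment_conv_lt_top hμ IsGaussian.integrable_id) h), hw⟩
  have W1_of_weak := fun h : _ ∧ _ => tendsto_W1_of_tendsto (μs := μs) hμ h.1 h.2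
  exact ⟨⟨weak_of_smoothed, fun h => smoothed_of_W1 (W1_of_weak h)⟩,
    fun h => W1_of_weak (weak_of_smoothed h), smoothed_of_W1⟩
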